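/- Let $d$ and $k$ be positive integers, and let $\mathbf L=(L_1,\dots,L_d)\in\mathbb Z^d$ and $\mathbf N^{(j)}=(N^{(j)}_1,\dots,N^{(j)}_d)\in\mathbb Z^d$, $j=1,\dots,k$, be integer vectors with $0\le L_i\le N^{(1)}_i$ for all $i$ and $N^{(j)}_i\ge 0$ for all $i$ and all $j=2,\dots,k$. For a vector $\mathbf m=(m_1,\dots,m_d)$ of non-negative integers write $\mathbf N^{(j)}\cdot\mathbf m=\sum_{i=1}^d N^{(j)}_i m_i$, $\mathbf L\cdot\mathbf m=\sum_{i=1}^d L_i m_i$ and $\mathbf z^{\mathbf m}=z_1^{m_1}\cdots z_d^{m_d}$, and let $H_n=\sum_{j=1}^n \frac1j$ (with $H_0=0$) denote the harmonic numbers. Define the formal power series $$F_{\mathbf N}(\mathbf z)=\sum_{\mathbf m\ge \mathbf 0}\mathbf z^{\mathbf m}\prod_{j=1}^k\frac{(\mathbf N^{(j)}\cdot\mathbf m)!}{\prod_{i=1}^d m_i!^{\,N^{(j)}_i}},\qquad G_{\mathbf L,\mathbf N}(\mathbf z)=\sum_{\mathbf m\ge \mathbf 0}\mathbf z^{\mathbf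 m}\,H_{\mathbf L\cdot\mathbf m}\prod_{j=1}^k\frac{(\mathbf N^{(j)}\cdot\mathbf m)!}{\prod_{i=1}^d m_i!^{\,N^{(j)}_i}}$$ in $\mathbb Q[[z_1,\dots,z_d]]$; here $F_{\mathbf N}$ has constant term $1$ and $G_{\mathbf L,\mathbf N}$ has constant term $0$. Then $$q_{\mathbf L,\mathbf N}(\mathbf z):=\exp\big(G_{\mathbf L,\mathbf N}(\mathbf z)/F_{\mathbf N}(\mathbf z)\big)\in\mathbb Z[[z_1,\dots,z_d]].$$ -/

import Mathlib

namespace MirrorType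

open scoped Nat

/-- The scalar product `P · m = ∑ i, P i * m i` of two vectors of non-negative integers. -/
def dot {d : ℕ} (P : Fin d → ℕ) (m : Fin d →₀ ℕ) : ℕ := ∑ i, P i * m i

/-- The coefficient `∏ j, (N⁽ʲ⁾ · m)! / ∏ i, (m i)! ^ N⁽ʲ⁾ i`, as a rational number. -/
def coeffB {d k : ℕ} (N : Fin k → Fin d → ℕ) (m : Fin d →₀ ℕ) : ℚ :=
  ∏ j, ((dot (N j) m)! : ℚ) / ∏ i, ((m i)! : ℚ) ^ N j i

/-- The series `F_N(z) = ∑ m, coeffB N m * z ^ m`. -/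
def seriesF {d k : ℕ} (N : Fin k → Fin d → ℕ) : MvPowerSeries (Fin d) ℚ :=
  fun m => coeffB N m

/-- The series `G_{L,N}(z) = ∑ m, H_{L · m} * coeffB N m * z ^ m`, where `H` denotes the
harmonic numbers. -/
def seriesG {d k : ℕ} (L : Fin d → ℕ) (N : Fin k → Fin d → ℕ) : MvPowerSeries (Fin d) ℚ :=
  fun m => harmonic (dot L m) * coeffB N m

/-- The mirror-type map `q_{L,N}(z) = exp (G_{L,N}(z) / F_N(z))`: the formal power series
obtained by substituting `G_{L,N} / F_N` in the exponential series. The quotient and the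
substitution are meaningful by `constantCoeff_seriesF` and `hasSubst_div` below. -/
noncomputable def mirrorMap {d k : ℕ} (L : Fin d → ℕ) (N : Fin k → Fin d → ℕ) :
    MvPowerSeries (Fin d) ℚ :=
  (PowerSeries.exp ℚ).subst (seriesG L N * (seriesF N)⁻¹)

theorem constantCoeff_seriesF {d k : ℕ} (N : Fin k → Fin d → ℕ) :
    MvPowerSeries.constantCoeff (seriesF N) = 1 := by
  change coeffB N 0 = 1
  simp [coeffB, dot]

theorem constantCoeff_seriesG {d k : ℕ} (L : Fin d → ℕ) (N : Fin k → Fin d → ℕ) :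
    MvPowerSeries.constantCoeff (seriesG L N) = 0 := by
  change harmonic (dot L 0) * coeffB N 0 = 0
  simp [dot]

theorem seriesF_mul_inv {d k : ℕ} (N : Fin k → Fin d → ℕ) :
    seriesF N * (seriesF N)⁻¹ = 1 :=
  MvPowerSeries.mul_inv_cancel _ (by rw [constantCoeff_seriesF]; exact one_ne_zero)

theorem hasSubst_div {d k : ℕ} (L : Fin d → ℕ) (N : Fin k → Fin d → ℕ) :
    PowerSeries.HasSubst (seriesG L N * (seriesF N)⁻¹) := by
  apply PowerSeries.HasSubst.of_constantCoeff_zero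
  rw [map_mul, constantCoeff_seriesG, zero_mul]

end MirrorType

namespace MirrorType

open scoped Nat
open Finset

/-! ### Exponentials of formal power series and the Dieudonné–Dwork criterion -/

section Exponential

variable {σ : Type*}

/-! A rational number is an integer once it is `p`-integral for every prime `p`, so fix `p` and
write `B` for the coefficients of `F`. By the Dieudonné–Dwork criterion (`coeffLE_exp_of_expand`),
exp(G/F) is `p`-integral if f = G/F satisfies f(z^p) - p f(z) ≡ 0 mod p. Clearing the denominator
F(z)F(z^p), whose inverse is `p`-integral, this becomes F(z)G(z^p) - p G(z)F(z^p) ≡ 0 mod p.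

At the exponent a + pK with 0 ≤ a_i < p, the coefficient is Σ_{j ≤ K} B(a+pj) B(K-j) (H_{L·(K-j)} -
p H_{L·(a+pj)}). Modulo p, p H_n may be replaced by H_{⌊n/p⌋}, and H_{⌊L·(a+pj)/p⌋} by H_{L·j}: the
terms of the latter difference have denominators absorbed by B(a+pj) (`padicNorm_factorialQuot_le`,
the only place where L ≤ N^(1) enters). Up to sign, reflecting j ↦ K-j leaves Σ_j H_{L·j} (B(a+pj)
B(K-j) - B(j) B(a+p(K-j))).

This sum is treated by Dwork's method. The bracket, summed over a block ⌊j/p^s⌋ = m, is divisible by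
p^(s+1) B(m) (`padicNorm_dworkSum_le`). Telescoping H_{L·j} over the scales p^s gives differences
constant on such blocks, whose product with B(m) has denominator at most p^s
(`padicNorm_mul_harmonic_pow_le`). One factor p survives at each scale.

The block congruences rest on B(v+pm) = R_v(m) B(m), where R_v is `p`-integral and u ≡ u' mod p^s
implies R_v(u) ≡ R_v(u') mod p^(s+1) (`lipschitzRatio_factorialQuot`): removing the multiples of p
from factorials leaves products over complete blocks of residues. -/

theorem exp_subst_X_add_X :
    (PowerSeries.exp ℚ).subst (MvPowerSeries.X 0 + MvPowerSeries.X 1 : MvPowerSeries (Fin 2) ℚ) =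
      (PowerSeries.exp ℚ).subst (MvPowerSeries.X 0 : MvPowerSeries (Fin 2) ℚ) *
        (PowerSeries.exp ℚ).subst (MvPowerSeries.X 1 : MvPowerSeries (Fin 2) ℚ) := by
  ext e
  rw [PowerSeries.coeff_subst_X_zero_add_X_one, PowerSeries.coeff_subst_X_zero_subst_mul_X_one]
  simp only [PowerSeries.coeff_exp, eq_ratCast, Rat.cast_id]
  rw [Nat.cast_add_choose]
  have := Nat.factorial_ne_zero (e 0 + e 1)
  field_simp

/-- The identity for two independent variables, which is the binomial formula coefficientwise, is
specialised by substituting `f` and `g`. -/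
theorem exp_subst_add {f g : MvPowerSeries σ ℚ} (hf : MvPowerSeries.constantCoeff f = 0)
    (hg : MvPowerSeries.constantCoeff g = 0) :
    (PowerSeries.exp ℚ).subst (f + g) =
      (PowerSeries.exp ℚ).subst f * (PowerSeries.exp ℚ).subst g := by
  have ha : MvPowerSeries.HasSubst ![f, g] :=
    MvPowerSeries.hasSubst_of_constantCoeff_zero fun i => by fin_cases i <;> simp [hf, hg]
  have key : ∀ b : MvPowerSeries (Fin 2) ℚ, MvPowerSeries.constantCoeff b = 0 →
      MvPowerSeries.subst ![f, g] ((PowerSeries.exp ℚ).subst b) =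
        (PowerSeries.exp ℚ).subst (MvPowerSeries.subst ![f, g] b) := fun b hb => by
    have hb' : PowerSeries.HasSubst b := .of_constantCoeff_zero hb
    rw [PowerSeries.subst, MvPowerSeries.subst_comp_subst_apply hb'.const ha, PowerSeries.subst]
  have h := congrArg (MvPowerSeries.subst ![f, g]) exp_subst_X_add_X
  rw [MvPowerSeries.subst_mul ha, key _ (by simp), key _ (by simp), key _ (by simp),
    MvPowerSeries.subst_add ha, MvPowerSeries.subst_X ha, MvPowerSeries.subst_X ha] at h
  simpa using h

theorem exp_subst_zero : (PowerSeries.exp ℚ).subst (0 : MvPowerSeries σ ℚ) = 1 := by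
  rw [PowerSeries.subst_zero_eq_C_constantCoeff]
  simp

theorem exp_subst_nsmul {f : MvPowerSeries σ ℚ} (hf : MvPowerSeries.constantCoeff f = 0) (n : ℕ) :
    (PowerSeries.exp ℚ).subst (n • f) = (PowerSeries.exp ℚ).subst f ^ n := by
  induction n with
  | zero => simp [exp_subst_zero]
  | succ n ih =>
    rw [succ_nsmul, exp_subst_add (by simp [hf]) hf, ih, pow_succ]

theorem constantCoeff_exp_subst {f : MvPowerSeries σ ℚ}
    (hf : MvPowerSeries.constantCoeff f = 0) :
    MvPowerSeries.constantCoeff ((PowerSeries.exp ℚ).subst f) = 1 := by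
  rw [PowerSeries.constantCoeff_subst (.of_constantCoeff_zero hf), finsum_eq_single _ 0]
  · simp
  · intro n hn
    simp [hf, hn]

theorem coeff_mul_of_coeff_eq_zero {r g : MvPowerSeries σ ℚ} {n : ℕ}
    (hr : ∀ e : σ →₀ ℕ, e.degree < n → MvPowerSeries.coeff e r = 0) {m : σ →₀ ℕ}
    (hm : m.degree ≤ n) :
    MvPowerSeries.coeff m (r * g) =
      MvPowerSeries.coeff m r * MvPowerSeries.constantCoeff g := by
  classical
  rw [MvPowerSeries.coeff_mul, Finset.sum_eq_single (m, 0)]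
  · simp [MvPowerSeries.coeff_zero_eq_constantCoeff_apply]
  · rintro ⟨a, b⟩ hab hne
    rw [HasAntidiagonal.mem_antidiagonal] at hab
    dsimp only at hab ⊢
    subst hab
    have hb : b ≠ 0 := fun hb => hne (by simp [hb])
    have : b.degree ≠ 0 := by rwa [Ne, Finsupp.degree_eq_zero_iff]
    rw [map_add] at hm
    rw [hr a (by omega), zero_mul]
  · simp

end Exponential

/-! ### `p`-adic bounds on coefficients -/

section Integrality

variable {σ : Type*} {p : ℕ}

/-- All coefficients of `f` have `p`-adic norm at most `c`. -/
def CoeffLE (p : ℕ) (f : MvPowerSeries σ ℚ) (c : ℚ) : Prop :=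
  ∀ m, padicNorm p (MvPowerSeries.coeff m f) ≤ c

theorem coeffLE_one : CoeffLE p (1 : MvPowerSeries σ ℚ) 1 := fun m => by
  classical
  rw [MvPowerSeries.coeff_one]
  split_ifs <;> simp

theorem degree_lt_degree {m n : σ →₀ ℕ} (h : m < n) : m.degree < n.degree := by
  obtain ⟨k, rfl⟩ := exists_add_of_le h.le
  have hk : k ≠ 0 := fun hk => by simp [hk] at h
  have : k.degree ≠ 0 := by rwa [Ne, Finsupp.degree_eq_zero_iff]
  rw [map_add]
  omega

variable [hp : Fact p.Prime]

theorem CoeffLE.mul {f g : MvPowerSeries σ ℚ} {a b : ℚ} (ha : 0 ≤ a) (hb : 0 ≤ b)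
    (hf : CoeffLE p f a) (hg : CoeffLE p g b) : CoeffLE p (f * g) (a * b) := fun m => by
  classical
  rw [MvPowerSeries.coeff_mul]
  refine padicNorm.sum_le' (fun x _ => ?_) (mul_nonneg ha hb)
  rw [padicNorm.mul]
  exact mul_le_mul (hf _) (hg _) (padicNorm.nonneg _) ha

theorem CoeffLE.pow {f : MvPowerSeries σ ℚ} (hf : CoeffLE p f 1) (n : ℕ) :
    CoeffLE p (f ^ n) 1 := by
  induction n with
  | zero => simpa using coeffLE_one
  | succ n ih => simpa [pow_succ] using ih.mul zero_le_one zero_le_one hf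

theorem CoeffLE.inv {f : MvPowerSeries σ ℚ} (hf : CoeffLE p f 1)
    (h1 : MvPowerSeries.constantCoeff f = 1) : CoeffLE p f⁻¹ 1 := by
  classical
  suffices H : ∀ n (m : σ →₀ ℕ), m.degree = n → padicNorm p (MvPowerSeries.coeff m f⁻¹) ≤ 1 from
    fun m => H _ m rfl
  intro n
  induction n using Nat.strong_induction_on with
  | _ n ih =>
    intro m hm
    rw [MvPowerSeries.coeff_inv]
    split_ifs with h0
    · simp [h1]
    · rw [h1, inv_one, neg_one_mul, padicNorm.neg]
      refine padicNorm.sum_le' (fun x hx => ?_) zero_le_one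
      split_ifs with hlt
      · rw [padicNorm.mul]
        refine mul_le_one₀ (hf _) (padicNorm.nonneg _) (ih _ ?_ x.2 rfl)
        rw [← hm]
        exact degree_lt_degree hlt
      · simp

/-- Legendre's bound (p-1) v_p(n!) < n leaves at least one factor p, even for p = 2. -/
theorem padicNorm_pow_div_factorial_le {n : ℕ} (hn : n ≠ 0) :
    padicNorm p ((p : ℚ) ^ n / (n ! : ℚ)) ≤ (p : ℚ)⁻¹ := by
  have hp0 : (p : ℚ) ≠ 0 := by exact_mod_cast hp.out.ne_zero
  have hlt : padicValNat p n ! < n := by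
    have h := sub_one_mul_padicValNat_factorial_lt_of_ne_zero p hn
    have : 1 ≤ p - 1 := by have := hp.out.two_le; omega
    nlinarith
  have hnorm : padicNorm p (n ! : ℚ) = (p : ℚ) ^ (-(padicValNat p n ! : ℤ)) := by
    rw [padicNorm.eq_zpow_of_nonzero (by positivity), padicValRat.of_nat]
  have hpow : padicNorm p ((p : ℚ) ^ n) = (p : ℚ) ^ (-(n : ℤ)) := by
    rw [padicNorm.eq_zpow_of_nonzero (by positivity), padicValRat.pow, padicValRat.self hp.out.one_lt]
    simp
  rw [padicNorm.div, hnorm, hpow, ← zpow_sub₀ hp0, ← zpow_neg_one]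
  exact zpow_le_zpow_right₀ (by exact_mod_cast hp.out.one_le) (by omega)

theorem coeffLE_exp_nsmul_sub_one {h : MvPowerSeries σ ℚ} (hh : CoeffLE p h 1)
    (h0 : MvPowerSeries.constantCoeff h = 0) :
    CoeffLE p ((PowerSeries.exp ℚ).subst (p • h) - 1) (p : ℚ)⁻¹ := fun m => by
  classical
  have hs : PowerSeries.HasSubst (p • h) := .of_constantCoeff_zero (by simp [h0])
  have hp0 : (0 : ℚ) ≤ (p : ℚ)⁻¹ := by positivity
  rcases eq_or_ne m 0 with rfl | hm
  · rw [MvPowerSeries.coeff_zero_eq_constantCoeff_apply, map_sub,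
      constantCoeff_exp_subst (by simp [h0]), map_one, sub_self, padicNorm.zero]
    exact hp0
  · rw [map_sub, MvPowerSeries.coeff_one, if_neg hm, sub_zero, PowerSeries.coeff_subst hs,
      finsum_eq_sum _ (PowerSeries.coeff_subst_finite hs _ m)]
    refine padicNorm.sum_le' (fun n _ => ?_) hp0
    rcases eq_or_ne n 0 with rfl | hn
    · simp [MvPowerSeries.coeff_one, hm, hp0]
    · have : PowerSeries.coeff n (PowerSeries.exp ℚ) • MvPowerSeries.coeff m ((p • h) ^ n) =
          ((p : ℚ) ^ n / (n ! : ℚ)) * MvPowerSeries.coeff m (h ^ n) := by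
        rw [smul_pow, map_nsmul]
        simp only [PowerSeries.coeff_exp, eq_ratCast, Rat.cast_id, smul_eq_mul, nsmul_eq_mul,
          Nat.cast_pow]
        ring
      rw [this, padicNorm.mul]
      calc _ ≤ (p : ℚ)⁻¹ * 1 := mul_le_mul (padicNorm_pow_div_factorial_le hn) (hh.pow n m)
            (padicNorm.nonneg _) hp0
        _ = _ := mul_one _

/-- Lift the coefficients to ℤ_p and reduce modulo p: over 𝔽_p, the Frobenius gives t(z)^p = t(z^p).
-/
theorem coeffLE_pow_sub_expand [Finite σ] {t : MvPowerSeries σ ℚ} (ht : CoeffLE p t 1) :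
    CoeffLE p (t ^ p - MvPowerSeries.expand p hp.out.ne_zero t) (p : ℚ)⁻¹ := by
  have ht' : ∀ m, ‖((MvPowerSeries.coeff m t : ℚ) : ℚ_[p])‖ ≤ 1 := fun m => by
    rw [Padic.eq_padicNorm]; exact_mod_cast ht m
  let T : MvPowerSeries σ ℤ_[p] := fun m => ⟨_, ht' m⟩
  have hT : MvPowerSeries.map (algebraMap ℤ_[p] ℚ_[p]) T =
      MvPowerSeries.map (Rat.castHom ℚ_[p]) t := by
    ext m; rfl
  have h0 : MvPowerSeries.map (PadicInt.toZMod (p := p))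
      (T ^ p - MvPowerSeries.expand p hp.out.ne_zero T) = 0 := by
    have h := MvPowerSeries.map_frobenius_expand p hp.out.ne_zero
      (f := MvPowerSeries.map (PadicInt.toZMod (p := p)) T)
    rw [map_sub, map_pow, MvPowerSeries.map_expand, ← h, ZMod.frobenius_zmod]
    simp
  intro m
  have h1 : MvPowerSeries.coeff m (T ^ p - MvPowerSeries.expand p hp.out.ne_zero T) ∈
      RingHom.ker (PadicInt.toZMod (p := p)) := by
    rw [RingHom.mem_ker, ← MvPowerSeries.coeff_map, h0, map_zero]
  rw [PadicInt.ker_toZMod, PadicInt.maximalIdeal_eq_span_p] at h1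
  have h2 := (PadicInt.norm_le_pow_iff_mem_span_pow _ 1).2 (by rwa [pow_one])
  have h3 : algebraMap ℤ_[p] ℚ_[p]
      (MvPowerSeries.coeff m (T ^ p - MvPowerSeries.expand p hp.out.ne_zero T)) =
      Rat.castHom ℚ_[p]
        (MvPowerSeries.coeff m (t ^ p - MvPowerSeries.expand p hp.out.ne_zero t)) := by
    rw [← MvPowerSeries.coeff_map, ← MvPowerSeries.coeff_map]
    congr 1
    rw [map_sub, map_pow, MvPowerSeries.map_expand, hT, map_sub, map_pow,
      MvPowerSeries.map_expand]
  rw [PadicInt.norm_def, ← PadicInt.algebraMap_apply, h3, eq_ratCast, Padic.eq_padicNorm] at h2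
  have h4 : (padicNorm p (MvPowerSeries.coeff m
      (t ^ p - MvPowerSeries.expand p hp.out.ne_zero t)) : ℝ) ≤ (((p : ℚ)⁻¹ : ℚ) : ℝ) := by
    simpa using h2
  exact_mod_cast h4

/-- The Dieudonné–Dwork criterion. -/
theorem coeffLE_exp_of_expand [Finite σ] {f : MvPowerSeries σ ℚ}
    (h0 : MvPowerSeries.constantCoeff f = 0)
    (hf : CoeffLE p (MvPowerSeries.expand p hp.out.ne_zero f - p • f) (p : ℚ)⁻¹) :
    CoeffLE p ((PowerSeries.exp ℚ).subst f) 1 := by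
  classical
  have hpq : (p : ℚ) ≠ 0 := by exact_mod_cast hp.out.ne_zero
  have hpi : (0 : ℚ) ≤ (p : ℚ)⁻¹ := by positivity
  set h : MvPowerSeries σ ℚ :=
    (p : ℚ)⁻¹ • (MvPowerSeries.expand p hp.out.ne_zero f - p • f) with hh
  have hph : p • h = MvPowerSeries.expand p hp.out.ne_zero f - p • f := by
    rw [hh, ← Nat.cast_smul_eq_nsmul ℚ p, smul_smul, mul_inv_cancel₀ hpq, one_smul]
  have hh1 : CoeffLE p h 1 := fun m => by
    rw [hh, map_smul, smul_eq_mul, padicNorm.mul]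
    calc _ ≤ padicNorm p (p : ℚ)⁻¹ * (p : ℚ)⁻¹ :=
          mul_le_mul_of_nonneg_left (hf m) (padicNorm.nonneg _)
      _ = 1 := by
          have := padicNorm.div (p := p) 1 p
          rw [padicNorm.one, one_div, padicNorm.padicNorm_p_of_prime, one_div, inv_inv] at this
          rw [this, mul_inv_cancel₀ hpq]
  have hh0 : MvPowerSeries.constantCoeff h = 0 := by
    rw [hh, MvPowerSeries.constantCoeff_smul, map_sub, MvPowerSeries.constantCoeff_expand, h0]
    simp [h0]
  have hs : PowerSeries.HasSubst f := .of_constantCoeff_zero h0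
  set q := (PowerSeries.exp ℚ).subst f with hq
  set u := (PowerSeries.exp ℚ).subst (p • h) with hu
  -- Since f(z^p) = p f + p h, exponentiating gives q(z^p) = q(z)^p u with u = exp(p h) ≡ 1 mod p.
  -- The coefficients of q are then controlled by induction on the degree.
  have hqe : MvPowerSeries.expand p hp.out.ne_zero q = q ^ p * u := by
    rw [hq, PowerSeries.expand_subst _ _ hs, hu, ← exp_subst_nsmul h0,
      ← exp_subst_add (by simp [h0]) (by simp [hh0]), hph, add_sub_cancel]
  have hu1 : CoeffLE p (u - 1) (p : ℚ)⁻¹ := coeffLE_exp_nsmul_sub_one hh1 hh0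
  have hu0 : MvPowerSeries.constantCoeff (u - 1) = 0 := by
    rw [map_sub, hu, constantCoeff_exp_subst (by simp [hh0]), map_one, sub_self]
  suffices H : ∀ n (m : σ →₀ ℕ), m.degree = n → padicNorm p (MvPowerSeries.coeff m q) ≤ 1 from
    fun m => H _ m rfl
  intro n
  induction n using Nat.strong_induction_on with
  | _ n ih =>
    intro m hm
    rcases eq_or_ne m 0 with rfl | hm0
    · rw [MvPowerSeries.coeff_zero_eq_constantCoeff_apply, hq, constantCoeff_exp_subst h0,
        padicNorm.one]
    have hn : n ≠ 0 := by rwa [← hm, Ne, Finsupp.degree_eq_zero_iff]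
    -- The truncation of q below degree n is integral by induction; the remainder r = q - t carries
    -- the unknown coefficient at m.
    let t : MvPowerSeries σ ℚ := fun e => if e.degree < n then MvPowerSeries.coeff e q else 0
    have htc : ∀ e, MvPowerSeries.coeff e t = if e.degree < n then MvPowerSeries.coeff e q else 0 :=
      fun e => rfl
    have ht : CoeffLE p t 1 := fun e => by
      rw [htc]
      split_ifs with he
      · exact ih _ he e rfl
      · simp
    set r := q - t with hr
    have hr0 : ∀ e : σ →₀ ℕ, e.degree < n → MvPowerSeries.coeff e r = 0 := fun e he => by
      rw [hr, map_sub, htc, if_pos he, sub_self]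
    have hrm : MvPowerSeries.coeff m r = MvPowerSeries.coeff m q := by
      rw [hr, map_sub, htc, if_neg (by omega), sub_zero]
    have hq0 : MvPowerSeries.constantCoeff q = 1 := constantCoeff_exp_subst h0
    have ht0 : MvPowerSeries.constantCoeff t = 1 := by
      rw [← MvPowerSeries.coeff_zero_eq_constantCoeff_apply, htc, if_pos (by simp; omega),
        MvPowerSeries.coeff_zero_eq_constantCoeff_apply, hq0]
    set g := ∑ i ∈ range p, q ^ i * t ^ (p - 1 - i) with hg
    have hg0 : MvPowerSeries.constantCoeff g = p := by
      simp [hg, hq0, ht0]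
    have hqp : q ^ p = t ^ p + r * g := by
      rw [mul_comm r g, hg, hr, geom_sum₂_mul]
      ring
    -- A coefficient of q(z^p) in degree n comes from degree n/p < n, where q and t agree.
    have hexp : MvPowerSeries.coeff m (MvPowerSeries.expand p hp.out.ne_zero q) =
        MvPowerSeries.coeff m (MvPowerSeries.expand p hp.out.ne_zero t) := by
      rw [← sub_eq_zero, ← map_sub, ← map_sub, ← hr]
      by_cases hd : ∀ i, p ∣ m i
      · obtain ⟨k, rfl⟩ : ∃ k : σ →₀ ℕ, p • k = m :=
          ⟨m.mapRange (fun a => a / p) (by simp), by ext i; simp [Nat.mul_div_cancel' (hd i)]⟩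
        rw [MvPowerSeries.coeff_expand_smul]
        apply hr0
        rw [map_nsmul, smul_eq_mul] at hm
        have hk : k.degree ≠ 0 := fun h => hn (by rw [← hm, h, mul_zero])
        have := hp.out.two_le
        nlinarith [Nat.pos_of_ne_zero hk]
      · push Not at hd
        obtain ⟨i, hi⟩ := hd
        exact MvPowerSeries.coeff_expand_of_not_dvd p _ _ hi
    -- In degree n only the constant term p of g meets r, and r(u-1) contributes nothing; what
    -- remains involves t alone.
    have hkey : (p : ℚ) * MvPowerSeries.coeff m q =
        -(MvPowerSeries.coeff m (t ^ p - MvPowerSeries.expand p hp.out.ne_zero t) +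
          MvPowerSeries.coeff m (t ^ p * (u - 1))) := by
      have h1 := congrArg (MvPowerSeries.coeff m) hqe
      rw [hexp, show q ^ p * u = t ^ p + r * g + t ^ p * (u - 1) + r * (g * (u - 1)) by
        rw [hqp]; ring, map_add, map_add, map_add, coeff_mul_of_coeff_eq_zero hr0 hm.le,
        coeff_mul_of_coeff_eq_zero hr0 hm.le, map_mul MvPowerSeries.constantCoeff, hu0, hg0, hrm] at h1
      rw [map_sub]
      linarith
    have hb : padicNorm p ((p : ℚ) * MvPowerSeries.coeff m q) ≤ (p : ℚ)⁻¹ := by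
      rw [hkey, padicNorm.neg]
      refine padicNorm.nonarchimedean.trans (max_le (coeffLE_pow_sub_expand ht m) ?_)
      simpa using (ht.pow p).mul zero_le_one hpi hu1 m
    rw [padicNorm.mul, padicNorm.padicNorm_p_of_prime] at hb
    have hpp : (0 : ℚ) < (p : ℚ)⁻¹ := by have := hp.out.pos; positivity
    exact le_of_mul_le_mul_left (by simpa using hb) hpp

/-- A rational number that is `p`-integral for every prime `p` is an integer. -/
theorem exists_int_of_padicNorm_le_one {x : ℚ} (h : ∀ p : ℕ, p.Prime → padicNorm p x ≤ 1) :
    ∃ z : ℤ, (z : ℚ) = x := by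
  refine ⟨x.num, ?_⟩
  rw [← Rat.den_eq_one_iff]
  by_contra hd
  obtain ⟨p, hp, hpd⟩ := Nat.exists_prime_and_dvd hd
  have := Fact.mk hp
  have h1 : padicNorm p (x.den : ℚ) < 1 := (padicNorm.nat_lt_one_iff _).2 hpd
  have h2 : padicNorm p (x.num : ℚ) = 1 := by
    rw [padicNorm.int_eq_one_iff]
    intro hpn
    have := Nat.dvd_gcd (Int.natCast_dvd.1 hpn) hpd
    rw [x.reduced] at this
    exact hp.one_lt.ne' (Nat.dvd_one.1 this)
  have h3 : padicNorm p (x * x.den) < 1 := by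
    rw [padicNorm.mul]
    exact mul_lt_one_of_nonneg_of_lt_one_right (h p hp) (padicNorm.nonneg _) h1
  rw [Rat.mul_den_eq_num, h2] at h3
  exact lt_irrefl _ h3

end Integrality

/-! ### Dwork's formal congruences -/

section FormalCongruence

/-- A weight depending only on `g j` factors out of each fibre, so cancellation inside the fibres
can be used. -/
theorem padicNorm_sum_comp_mul_le {α β : Type*} [DecidableEq β] {p : ℕ} [hp : Fact p.Prime]
    (T : Finset α) (g : α → β) (c : β → ℚ) (X : α → ℚ) {b : ℚ} (hb : 0 ≤ b)
    (h : ∀ y ∈ T.image g, padicNorm p (c y * ∑ j ∈ T with g j = y, X j) ≤ b) :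
    padicNorm p (∑ j ∈ T, c (g j) * X j) ≤ b := by
  rw [← sum_fiberwise_of_maps_to (t := T.image g) (g := g) fun j hj => mem_image_of_mem g hj]
  refine padicNorm.sum_le' (fun y hy => ?_) hb
  convert h y hy using 2
  rw [mul_sum]
  refine sum_congr rfl fun j hj => ?_
  rw [(mem_filter.1 hj).2]

variable {ι : Type*}

/-- Entrywise integer division. -/
def qdiv (j : ι → ℕ) (q : ℕ) : ι → ℕ := fun i => j i / q

@[simp] theorem qdiv_apply (j : ι → ℕ) (q : ℕ) (i : ι) : qdiv j q i = j i / q := rfl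

@[simp] theorem qdiv_one (j : ι → ℕ) : qdiv j 1 = j := by ext i; simp

theorem qdiv_qdiv (j : ι → ℕ) (q r : ℕ) : qdiv (qdiv j q) r = qdiv j (q * r) := by
  ext i; simp [Nat.div_div_eq_div_mul]

theorem qdiv_add_smul {q : ℕ} {v : ι → ℕ} (hv : ∀ i, v i < q) (m : ι → ℕ) :
    qdiv (v + q • m) q = m := by
  ext i
  have : 0 < q := (Nat.zero_le _).trans_lt (hv i)
  simp [Nat.add_mul_div_left _ _ this, Nat.div_eq_of_lt (hv i)]

variable [Fintype ι] [DecidableEq ι]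

/-- The antisymmetrized product occurring in Dwork's congruences. -/
def dworkTerm (A : (ι → ℕ) → ℚ) (p : ℕ) (a K j : ι → ℕ) : ℚ :=
  A (a + p • j) * A (K - j) - A j * A (a + p • (K - j))

/-- The partial sum of `dworkTerm` over the indices `j ≤ K` with `⌊j / p ^ s⌋ = m`. -/
def dworkSum (A : (ι → ℕ) → ℚ) (p : ℕ) (a K : ι → ℕ) (s : ℕ) (m : ι → ℕ) : ℚ :=
  ∑ j ∈ Iic K with qdiv j (p ^ s) = m, dworkTerm A p a K j

/-- The reflection j ↦ K - j reverses the sign of each term. -/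
theorem sum_dworkTerm (A : (ι → ℕ) → ℚ) (p : ℕ) (a K : ι → ℕ) :
    ∑ j ∈ Iic K, dworkTerm A p a K j = 0 := by
  simp only [dworkTerm]
  rw [sum_sub_distrib, sub_eq_zero]
  refine sum_nbij' (fun j => K - j) (fun j => K - j) ?_ ?_ ?_ ?_ ?_
  · intro j _; simp
  · intro j _; simp
  · intro j hj; exact tsub_tsub_cancel_of_le (mem_Iic.1 hj)
  · intro j hj; exact tsub_tsub_cancel_of_le (mem_Iic.1 hj)
  · intro j hj
    rw [tsub_tsub_cancel_of_le (mem_Iic.1 hj), mul_comm]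

/-- The hypotheses on the coefficients in Dwork's congruences. -/
structure DworkFamily (p : ℕ) (A : (ι → ℕ) → ℚ) : Prop where
  map_zero : A 0 = 1
  ne_zero : ∀ m, A m ≠ 0
  norm_le_one : ∀ m, padicNorm p (A m) ≤ 1
  ratio : ∀ (j n : ι → ℕ) (s : ℕ), qdiv j (p ^ (s + 1)) = 0 →
    padicNorm p (A (j + p ^ (s + 1) • n) / A j - A (qdiv j p + p ^ s • n) / A (qdiv j p)) ≤
      (p : ℚ)⁻¹ ^ (s + 1) * padicNorm p (A n) / padicNorm p (A j)

variable {p : ℕ} [hp : Fact p.Prime] {A : (ι → ℕ) → ℚ}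

/-- Translating the zero block by p^s m nearly multiplies its sum by A(m). The translation
multiplies individual terms by about A(j+p^s m)/A(j); this factor is deformed to A(m)/A(0) scale by
scale, using the congruences already known at smaller scales. -/
theorem dworkSum_shift_sub (hA : DworkFamily p A) {a : ι → ℕ} (ha : ∀ i, a i < p) {s : ℕ}
    (ih : ∀ t < s, ∀ K m, padicNorm p (dworkSum A p a K t m) ≤
      (p : ℚ)⁻¹ ^ (t + 1) * padicNorm p (A m)) (K m : ι → ℕ) :
    padicNorm p (dworkSum A p a (K + p ^ s • m) s m - A m * dworkSum A p a K s 0) ≤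
      (p : ℚ)⁻¹ ^ (s + 1) * padicNorm p (A m) := by
  have hpp : 0 < p := hp.out.pos
  have hps : 0 < p ^ s := pow_pos hpp s
  set b : ℚ := (p : ℚ)⁻¹ ^ (s + 1) * padicNorm p (A m) with hb
  have hb0 : 0 ≤ b := mul_nonneg (by positivity) (padicNorm.nonneg _)
  set T : Finset (ι → ℕ) := {j ∈ Iic K | qdiv j (p ^ s) = 0} with hT
  -- Evaluated at y = ⌊j/p^t⌋, this is the translation factor at t = 0 and A(m) at t = s on the zero
  -- block.
  let e : ℕ → (ι → ℕ) → ℚ := fun t y => A (y + p ^ (s - t) • m) / A y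
  have hshift : dworkSum A p a (K + p ^ s • m) s m =
      ∑ j ∈ T, dworkTerm A p a (K + p ^ s • m) (j + p ^ s • m) := by
    symm
    refine sum_nbij' (fun j => j + p ^ s • m) (fun j => j - p ^ s • m) ?_ ?_ ?_ ?_ ?_
    · intro j hj
      simp only [hT, mem_filter, mem_Iic] at hj ⊢
      refine ⟨add_le_add_left hj.1 _, ?_⟩
      ext i
      have := congrFun hj.2 i
      simp only [qdiv_apply, Pi.zero_apply] at this
      simp [Nat.add_mul_div_left _ _ hps, this]
    · intro j hj
      simp only [hT, mem_filter, mem_Iic] at hj ⊢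
      refine ⟨tsub_le_iff_right.2 hj.1, ?_⟩
      ext i
      have := congrFun hj.2 i
      simp only [qdiv_apply] at this
      simp only [qdiv_apply, Pi.sub_apply, Pi.smul_apply, smul_eq_mul, Pi.zero_apply]
      rw [Nat.sub_mul_div, this, Nat.sub_self]
    · intro j _
      simp
    · intro j hj
      simp only [mem_filter, mem_Iic] at hj
      refine tsub_add_cancel_of_le fun i => ?_
      have := congrFun hj.2 i
      simp only [qdiv_apply] at this
      simp only [Pi.smul_apply, smul_eq_mul]
      rw [← this]
      exact Nat.mul_div_le _ _
    · intro j _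
      rfl
  have hfirst : padicNorm p (∑ j ∈ T, (dworkTerm A p a (K + p ^ s • m) (j + p ^ s • m) -
      e 0 j * dworkTerm A p a K j)) ≤ b := by
    -- The second products of the two antisymmetrized terms cancel exactly, leaving the ratio
    -- hypothesis at a + pj, whose quotient by p is j.
    refine padicNorm.sum_le' (fun j hj => ?_) hb0
    have hj0 : qdiv (a + p • j) (p ^ (s + 1)) = 0 := by
      rw [pow_succ', ← qdiv_qdiv, qdiv_add_smul ha]
      exact (mem_filter.1 hj).2
    have h1 := hA.ne_zero j
    have h2 := hA.ne_zero (a + p • j)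
    have hsub : K + p ^ s • m - (j + p ^ s • m) = K - j := add_tsub_add_eq_tsub_right _ _ _
    have hadd : a + p • (j + p ^ s • m) = a + p • j + p ^ (s + 1) • m := by
      ext i; simp; ring
    have : dworkTerm A p a (K + p ^ s • m) (j + p ^ s • m) - e 0 j * dworkTerm A p a K j =
        A (K - j) * (A (a + p • j) * (A (a + p • j + p ^ (s + 1) • m) / A (a + p • j) -
          A (qdiv (a + p • j) p + p ^ s • m) / A (qdiv (a + p • j) p))) := by
      simp only [dworkTerm, e, hsub, hadd, qdiv_add_smul ha, Nat.sub_zero]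
      field_simp
      ring
    rw [this, padicNorm.mul, padicNorm.mul]
    have hpos : 0 < padicNorm p (A (a + p • j)) :=
      lt_of_le_of_ne (padicNorm.nonneg _) (padicNorm.nonzero h2).symm
    calc _ ≤ 1 * (padicNorm p (A (a + p • j)) * (b / padicNorm p (A (a + p • j)))) :=
          mul_le_mul (hA.norm_le_one _)
            (mul_le_mul_of_nonneg_left (hA.ratio _ _ _ hj0) hpos.le)
            (mul_nonneg hpos.le (padicNorm.nonneg _)) zero_le_one
      _ = b := by field_simp
  -- The change of factor costs |A(y)| in the denominator and gains p^(s-t); the inductive bound on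
  -- the block of y restores |A(y)| and gains p^(t+1).
  have hstep : ∀ t ∈ range s, padicNorm p (∑ j ∈ T,
      (e t (qdiv j (p ^ t)) - e (t + 1) (qdiv j (p ^ (t + 1)))) * dworkTerm A p a K j) ≤ b := by
    intro t ht
    rw [mem_range] at ht
    have := padicNorm_sum_comp_mul_le (p := p) T (fun j => qdiv j (p ^ t))
      (fun y => e t y - e (t + 1) (qdiv y p)) (dworkTerm A p a K) hb0 ?_
    · simpa only [qdiv_qdiv, ← pow_succ] using this
    intro y hy
    obtain ⟨j₀, hj₀, rfl⟩ := mem_image.1 hy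
    set y := qdiv j₀ (p ^ t) with hyd
    have hfib : ∑ j ∈ T with qdiv j (p ^ t) = y, dworkTerm A p a K j = dworkSum A p a K t y := by
      rw [dworkSum]
      refine sum_congr ?_ fun _ _ => rfl
      ext j
      simp only [hT, mem_filter]
      refine ⟨fun h => ⟨h.1.1, h.2⟩, fun h => ⟨⟨h.1, ?_⟩, h.2⟩⟩
      have h2 := (mem_filter.1 hj₀).2
      rw [← Nat.add_sub_cancel' ht.le, pow_add, ← qdiv_qdiv] at h2 ⊢
      rw [h.2]
      exact h2
    have hst : s - t = s - (t + 1) + 1 := by omega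
    rw [hfib, padicNorm.mul]
    have hpos : 0 < padicNorm p (A y) :=
      lt_of_le_of_ne (padicNorm.nonneg _) (padicNorm.nonzero (hA.ne_zero y)).symm
    have hy0 : qdiv y (p ^ (s - (t + 1) + 1)) = 0 := by
      rw [← hst, hyd, qdiv_qdiv, ← pow_add, Nat.add_sub_cancel' ht.le]
      exact (mem_filter.1 hj₀).2
    have hr := hA.ratio y m (s - (t + 1)) hy0
    simp only [e]
    rw [← hst] at hr
    calc _ ≤ ((p : ℚ)⁻¹ ^ (s - t) * padicNorm p (A m) / padicNorm p (A y)) *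
          ((p : ℚ)⁻¹ ^ (t + 1) * padicNorm p (A y)) :=
          mul_le_mul hr (ih t ht K y) (padicNorm.nonneg _) ((padicNorm.nonneg _).trans hr)
      _ = ((p : ℚ)⁻¹ ^ (s - t) * (p : ℚ)⁻¹ ^ (t + 1)) * padicNorm p (A m) := by field_simp
      _ = b := by rw [← pow_add, hb]; congr 2; omega
  have hlast : A m * dworkSum A p a K s 0 =
      ∑ j ∈ T, e s (qdiv j (p ^ s)) * dworkTerm A p a K j := by
    rw [dworkSum, mul_sum]
    refine sum_congr rfl fun j hj => ?_
    rw [(mem_filter.1 hj).2]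
    simp [e, hA.map_zero]
  have htel : dworkSum A p a (K + p ^ s • m) s m - A m * dworkSum A p a K s 0 =
      (∑ j ∈ T, (dworkTerm A p a (K + p ^ s • m) (j + p ^ s • m) -
        e 0 j * dworkTerm A p a K j)) + ∑ t ∈ range s, ∑ j ∈ T,
      (e t (qdiv j (p ^ t)) - e (t + 1) (qdiv j (p ^ (t + 1)))) * dworkTerm A p a K j := by
    rw [sum_comm, hshift, hlast, ← sum_sub_distrib, ← sum_add_distrib]
    refine sum_congr rfl fun j _ => ?_
    rw [← sum_mul, sum_range_sub' fun t => e t (qdiv j (p ^ t))]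
    simp only [pow_zero, qdiv_one]
    ring
  rw [htel]
  exact padicNorm.nonarchimedean.trans (max_le hfirst (padicNorm.sum_le' hstep hb0))

theorem padicNorm_dworkSum_le (hA : DworkFamily p A) {a : ι → ℕ} (ha : ∀ i, a i < p) (s : ℕ) :
    ∀ K m, padicNorm p (dworkSum A p a K s m) ≤ (p : ℚ)⁻¹ ^ (s + 1) * padicNorm p (A m) := by
  induction s using Nat.strong_induction_on with
  | _ s ih =>
    have hb0 : (0 : ℚ) ≤ (p : ℚ)⁻¹ ^ (s + 1) := by positivity
    have hps : 0 < p ^ s := pow_pos hp.out.pos s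
    have hred : ∀ K m, padicNorm p (dworkSum A p a K s 0) ≤ (p : ℚ)⁻¹ ^ (s + 1) →
        padicNorm p (dworkSum A p a (K + p ^ s • m) s m) ≤
          (p : ℚ)⁻¹ ^ (s + 1) * padicNorm p (A m) := fun K m h => by
      rw [← sub_add_cancel (dworkSum A p a (K + p ^ s • m) s m) (A m * dworkSum A p a K s 0)]
      refine padicNorm.nonarchimedean.trans (max_le (dworkSum_shift_sub hA ha ih K m) ?_)
      rw [padicNorm.mul, mul_comm]
      exact mul_le_mul_of_nonneg_right h (padicNorm.nonneg _)
    -- All blocks together sum to zero, so the zero block is minus the sum of the others; each of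
    -- these is a translated zero block for a smaller K.
    have hzero : ∀ n, ∀ K : ι → ℕ, ∑ i, K i = n →
        padicNorm p (dworkSum A p a K s 0) ≤ (p : ℚ)⁻¹ ^ (s + 1) := by
      intro n
      induction n using Nat.strong_induction_on with
      | _ n ihn =>
        intro K hK
        set M := (Iic K).image fun j => qdiv j (p ^ s) with hM
        have htot : ∑ m ∈ M, dworkSum A p a K s m = 0 := by
          rw [← sum_dworkTerm A p a K]
          exact sum_fiberwise_of_maps_to (fun j hj => mem_image_of_mem _ hj) _
        have h0 : (0 : ι → ℕ) ∈ M := mem_image.2 ⟨0, by simp, by ext i; simp⟩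
        rw [← add_sum_erase _ _ h0, add_eq_zero_iff_eq_neg] at htot
        rw [htot, padicNorm.neg]
        refine padicNorm.sum_le' (fun m hm => ?_) hb0
        obtain ⟨hm0, hmM⟩ := mem_erase.1 hm
        obtain ⟨j, hj, rfl⟩ := mem_image.1 hmM
        set m := qdiv j (p ^ s) with hmd
        have hle : p ^ s • m ≤ K := fun i =>
          (Nat.mul_div_le (j i) (p ^ s)).trans (mem_Iic.1 hj i)
        obtain ⟨K', rfl⟩ : ∃ K', K = K' + p ^ s • m := ⟨K - p ^ s • m, (tsub_add_cancel_of_le hle).symm⟩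
        have hlt : ∑ i, K' i < n := by
          obtain ⟨i, hi⟩ : ∃ i, m i ≠ 0 := by
            by_contra! h
            exact hm0 (funext h)
          rw [← hK]
          refine sum_lt_sum (fun i _ => by simp) ⟨i, mem_univ i, ?_⟩
          simp only [Pi.add_apply, Pi.smul_apply, smul_eq_mul]
          have := Nat.mul_pos hps (Nat.pos_of_ne_zero hi)
          omega
        calc _ ≤ (p : ℚ)⁻¹ ^ (s + 1) * padicNorm p (A m) := hred K' m (ihn _ hlt K' rfl)
          _ ≤ (p : ℚ)⁻¹ ^ (s + 1) * 1 := mul_le_mul_of_nonneg_left (hA.norm_le_one _) hb0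
          _ = _ := mul_one _
    intro K m
    by_cases hle : p ^ s • m ≤ K
    · obtain ⟨K', rfl⟩ : ∃ K', K = K' + p ^ s • m := ⟨K - p ^ s • m, (tsub_add_cancel_of_le hle).symm⟩
      exact hred K' m (hzero _ K' rfl)
    · have : dworkSum A p a K s m = 0 := by
        rw [dworkSum, filter_false_of_mem, sum_empty]
        rintro j hj rfl
        exact hle fun i => (Nat.mul_div_le (j i) (p ^ s)).trans (mem_Iic.1 hj i)
      rw [this, padicNorm.zero]
      exact mul_nonneg hb0 (padicNorm.nonneg _)

/-- Summation by parts over `p`-adic scales: the increment of h at scale t is constant on blocks,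
and its loss p^t is beaten by the gain p^(t+1) from the block sum. -/
theorem padicNorm_sum_mul_dworkTerm_le (hA : DworkFamily p A) {a : ι → ℕ} (ha : ∀ i, a i < p)
    {h : (ι → ℕ) → ℚ} (h0 : h 0 = 0)
    (hh : ∀ s m, padicNorm p (A m * (h (p ^ s • m) - h (p ^ (s + 1) • qdiv m p))) ≤ (p : ℚ) ^ s)
    (K : ι → ℕ) :
    padicNorm p (∑ j ∈ Iic K, h j * dworkTerm A p a K j) ≤ (p : ℚ)⁻¹ := by
  have hpq : (p : ℚ) ≠ 0 := by exact_mod_cast hp.out.ne_zero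
  have hb0 : (0 : ℚ) ≤ (p : ℚ)⁻¹ := by positivity
  -- Any exponent with p^r above every entry of K ends the telescoping at h(0) = 0.
  set r := ∑ i, K i with hr
  have hdiv : ∀ j ∈ Iic K, qdiv j (p ^ r) = 0 := fun j hj => by
    ext i
    refine Nat.div_eq_of_lt ?_
    calc j i ≤ K i := mem_Iic.1 hj i
      _ ≤ r := single_le_sum (f := K) (fun _ _ => Nat.zero_le _) (mem_univ i)
      _ < p ^ r := Nat.lt_pow_self hp.out.one_lt
  have htel : ∑ j ∈ Iic K, h j * dworkTerm A p a K j = ∑ t ∈ range r, ∑ j ∈ Iic K,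
      (h (p ^ t • qdiv j (p ^ t)) - h (p ^ (t + 1) • qdiv j (p ^ (t + 1)))) *
        dworkTerm A p a K j := by
    rw [sum_comm]
    refine sum_congr rfl fun j hj => ?_
    rw [← sum_mul, sum_range_sub' fun t => h (p ^ t • qdiv j (p ^ t)), hdiv j hj]
    simp [h0]
  rw [htel]
  refine padicNorm.sum_le' (fun t _ => ?_) hb0
  have := padicNorm_sum_comp_mul_le (p := p) (Iic K) (fun j => qdiv j (p ^ t))
      (fun y => h (p ^ t • y) - h (p ^ (t + 1) • qdiv y p)) (dworkTerm A p a K) hb0 ?_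
  · simpa only [qdiv_qdiv, ← pow_succ] using this
  intro y _
  rw [padicNorm.mul]
  calc _ ≤ padicNorm p (h (p ^ t • y) - h (p ^ (t + 1) • qdiv y p)) *
        ((p : ℚ)⁻¹ ^ (t + 1) * padicNorm p (A y)) :=
        mul_le_mul_of_nonneg_left (padicNorm_dworkSum_le hA ha t K y) (padicNorm.nonneg _)
    _ = (p : ℚ)⁻¹ ^ (t + 1) *
        padicNorm p (A y * (h (p ^ t • y) - h (p ^ (t + 1) • qdiv y p))) := by
        rw [padicNorm.mul]; ring
    _ ≤ (p : ℚ)⁻¹ ^ (t + 1) * (p : ℚ) ^ t :=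
        mul_le_mul_of_nonneg_left (hh t y) (by positivity)
    _ = (p : ℚ)⁻¹ := by
        rw [pow_succ, mul_right_comm, ← mul_pow, inv_mul_cancel₀ hpq, one_pow, one_mul]

end FormalCongruence

/-! ### Multinomial-type coefficients satisfy the hypotheses of Dwork's congruences -/

section BlockProduct

theorem ascFactorial_modEq (q a x c : ℕ) :
    (a + q * x).ascFactorial c ≡ a.ascFactorial c [MOD q] := by
  induction c with
  | zero => rfl
  | succ c ih =>
    rw [Nat.ascFactorial_succ, Nat.ascFactorial_succ]
    refine Nat.ModEq.mul ?_ ih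
    have : a + q * x + c = a + c + q * x := by ring
    rw [this]
    exact Nat.add_mul_mod_self_left _ _ _

theorem coprime_ascFactorial {p c : ℕ} (hp : p.Prime) (hc : c < p) (M : ℕ) :
    p.Coprime ((p * M + 1).ascFactorial c) := by
  induction c with
  | zero => simp
  | succ c ih =>
    rw [Nat.ascFactorial_succ]
    refine Nat.Coprime.mul_right ?_ (ih (by omega))
    rw [Nat.Prime.coprime_iff_not_dvd hp, add_assoc, ← Nat.dvd_add_iff_right (dvd_mul_right p M)]
    exact fun h => absurd (Nat.le_of_dvd (by omega) h) (by omega)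

/-- The product of the integers in `[1, p * M]` that are not divisible by `p`. -/
def primeToProd (p M : ℕ) : ℕ := ∏ i ∈ range M, (p * i + 1).ascFactorial (p - 1)

/-- The product of the integers in `[1, c + p * M]` except `p, 2 * p, …, M * p`. -/
def deletedFactorial (p c M : ℕ) : ℕ := primeToProd p M * (p * M + 1).ascFactorial c

theorem factorial_mul_eq {p : ℕ} (hp : 0 < p) (M : ℕ) :
    (p * M)! = p ^ M * M ! * primeToProd p M := by
  induction M with
  | zero => simp [primeToProd]
  | succ M ih =>
    obtain ⟨r, rfl⟩ : ∃ r, p = r + 1 := ⟨p - 1, by omega⟩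
    have : (r + 1) * (M + 1) = (r + 1) * M + r + 1 := by ring
    rw [this, Nat.factorial_succ, ← Nat.factorial_mul_ascFactorial, ih, primeToProd, primeToProd,
      prod_range_succ, Nat.factorial_succ, Nat.add_sub_cancel]
    ring

theorem factorial_add_mul_eq {p : ℕ} (hp : 0 < p) (c M : ℕ) :
    (c + p * M)! = p ^ M * M ! * deletedFactorial p c M := by
  rw [add_comm, ← Nat.factorial_mul_ascFactorial, factorial_mul_eq hp, deletedFactorial]
  ring

theorem coprime_primeToProd {p : ℕ} (hp : p.Prime) (M : ℕ) : p.Coprime (primeToProd p M) :=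
  Nat.Coprime.prod_right fun _ _ => coprime_ascFactorial hp (by have := hp.pos; omega) _

theorem coprime_deletedFactorial {p c : ℕ} (hp : p.Prime) (hc : c < p) (M : ℕ) :
    p.Coprime (deletedFactorial p c M) :=
  (coprime_primeToProd hp M).mul_right (coprime_ascFactorial hp hc M)

/-- Modulo p^(s+1), successive blocks of p^(s+1) integers give the same product. Its value need not
be known: its powers cancel between numerator and denominator of the factorial quotient. -/
theorem primeToProd_add_modEq (p s n M : ℕ) :
    primeToProd p (p ^ s * n + M) ≡ primeToProd p (p ^ s) ^ n * primeToProd p M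
      [MOD p ^ (s + 1)] := by
  have key : ∀ n M, primeToProd p (p ^ s * n + M) ≡
      primeToProd p (p ^ s * n) * primeToProd p M [MOD p ^ (s + 1)] := fun n M => by
    rw [primeToProd, prod_range_add]
    refine Nat.ModEq.mul_left _ (Nat.ModEq.prod fun i _ => ?_)
    have : p * (p ^ s * n + i) + 1 = p * i + 1 + p ^ (s + 1) * n := by ring
    rw [this]
    exact ascFactorial_modEq _ _ _ _
  refine (key n M).trans (Nat.ModEq.mul_right _ ?_)
  induction n with
  | zero => simp [primeToProd, Nat.ModEq.refl]
  | succ n ih =>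
    rw [mul_add, mul_one, pow_succ]
    exact (key n _).trans (Nat.ModEq.mul_right _ ih)

theorem deletedFactorial_add_modEq (p s c n M : ℕ) :
    deletedFactorial p c (M + p ^ s * n) ≡
      primeToProd p (p ^ s) ^ n * deletedFactorial p c M [MOD p ^ (s + 1)] := by
  rw [deletedFactorial, deletedFactorial, ← mul_assoc]
  refine Nat.ModEq.mul ?_ ?_
  · rw [add_comm M]
    exact primeToProd_add_modEq p s n M
  · have : p * (M + p ^ s * n) + 1 = p * M + 1 + p ^ (s + 1) * n := by ring
    rw [this]
    exact ascFactorial_modEq _ _ _ _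

end BlockProduct

/-! ### From Lipschitz ratios to Dwork's hypotheses -/

section Ratio

variable {ι : Type*} {p : ℕ}

/-- A function `A` with `A (v + p m) = R_v m * A m` for `p`-integral functions `R_v` that are
`p`-adically Lipschitz. -/
structure LipschitzRatio (p : ℕ) (A : (ι → ℕ) → ℚ) : Prop where
  map_zero : A 0 = 1
  ne_zero : ∀ m, A m ≠ 0
  exists_ratio : ∀ v : ι → ℕ, (∀ i, v i < p) → ∃ R : (ι → ℕ) → ℚ,
    (∀ m, A (v + p • m) = R m * A m) ∧ (∀ m, padicNorm p (R m) ≤ 1) ∧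
    ∀ (s : ℕ) (u n : ι → ℕ), padicNorm p (R (u + p ^ s • n) - R u) ≤ (p : ℚ)⁻¹ ^ (s + 1)

theorem lipschitzRatio_one : LipschitzRatio p (1 : (ι → ℕ) → ℚ) where
  map_zero := rfl
  ne_zero _ := one_ne_zero
  exists_ratio _ _ := ⟨1, by simp, by simp, fun s _ _ => by simp⟩

variable [hp : Fact p.Prime]

theorem LipschitzRatio.mul {A B : (ι → ℕ) → ℚ} (hA : LipschitzRatio p A)
    (hB : LipschitzRatio p B) : LipschitzRatio p (A * B) where
  map_zero := by simp [hA.map_zero, hB.map_zero]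
  ne_zero m := mul_ne_zero (hA.ne_zero m) (hB.ne_zero m)
  exists_ratio v hv := by
    obtain ⟨R, h1, h2, h3⟩ := hA.exists_ratio v hv
    obtain ⟨Q, k1, k2, k3⟩ := hB.exists_ratio v hv
    refine ⟨R * Q, fun m => ?_, fun m => ?_, fun s u n => ?_⟩
    · simp only [Pi.mul_apply, h1, k1]; ring
    · rw [Pi.mul_apply, padicNorm.mul]
      exact mul_le_one₀ (h2 m) (padicNorm.nonneg _) (k2 m)
    · have : (R * Q) (u + p ^ s • n) - (R * Q) u =
          R (u + p ^ s • n) * (Q (u + p ^ s • n) - Q u) + (R (u + p ^ s • n) - R u) * Q u := by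
        simp only [Pi.mul_apply]; ring
      rw [this]
      refine padicNorm.nonarchimedean.trans (max_le ?_ ?_) <;> rw [padicNorm.mul]
      · simpa using mul_le_mul (h2 _) (k3 s u n) (padicNorm.nonneg _) zero_le_one
      · simpa using mul_le_mul (h3 s u n) (k2 _) (padicNorm.nonneg _) (by positivity)

theorem LipschitzRatio.prod {κ : Type*} (T : Finset κ) {A : κ → (ι → ℕ) → ℚ}
    (hA : ∀ j ∈ T, LipschitzRatio p (A j)) : LipschitzRatio p (∏ j ∈ T, A j) :=
  prod_induction _ _ (fun _ _ => .mul) lipschitzRatio_one hA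

theorem mod_add_smul_qdiv (j : ι → ℕ) (p : ℕ) : (fun i => j i % p) + p • qdiv j p = j := by
  ext i
  simp [Nat.mod_add_div]

variable {A : (ι → ℕ) → ℚ}

theorem LipschitzRatio.norm_le_qdiv (hA : LipschitzRatio p A) (m : ι → ℕ) :
    padicNorm p (A m) ≤ padicNorm p (A (qdiv m p)) := by
  obtain ⟨R, h1, h2, -⟩ := hA.exists_ratio (fun i => m i % p) fun i => Nat.mod_lt _ hp.out.pos
  conv_lhs => rw [← mod_add_smul_qdiv m p, h1, padicNorm.mul]
  exact mul_le_of_le_one_left (padicNorm.nonneg _) (h2 _)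

theorem LipschitzRatio.norm_le_qdiv_pow (hA : LipschitzRatio p A) (m : ι → ℕ) (s : ℕ) :
    padicNorm p (A m) ≤ padicNorm p (A (qdiv m (p ^ s))) := by
  induction s with
  | zero => simp
  | succ s ih =>
    rw [pow_succ, ← qdiv_qdiv]
    exact ih.trans (hA.norm_le_qdiv _)

/-- With j = v + pu, the difference of ratios equals (R(u+p^s n) - R(u)) A(u+p^s n) / A(j). Deleting
base-p digits never decreases the norm of A, so |A(u+p^s n)| ≤ |A(n)|, and deleting all of them
gives |A(m)| ≤ |A(0)| = 1. -/
theorem LipschitzRatio.dworkFamily [Fintype ι] (hA : LipschitzRatio p A) :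
    DworkFamily p A where
  map_zero := hA.map_zero
  ne_zero := hA.ne_zero
  norm_le_one m := by
    refine (hA.norm_le_qdiv_pow m (∑ i, m i)).trans_eq ?_
    have : qdiv m (p ^ ∑ i, m i) = 0 := by
      ext i
      exact Nat.div_eq_of_lt ((single_le_sum (f := m) (fun _ _ => Nat.zero_le _)
        (mem_univ i)).trans_lt (Nat.lt_pow_self hp.out.one_lt))
    rw [this, hA.map_zero, padicNorm.one]
  ratio j n s hj := by
    obtain ⟨R, h1, -, h3⟩ := hA.exists_ratio (fun i => j i % p) fun i => Nat.mod_lt _ hp.out.pos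
    set v : ι → ℕ := fun i => j i % p
    set u := qdiv j p with hu
    have hjd : v + p • u = j := mod_add_smul_qdiv j p
    have h4 : A (j + p ^ (s + 1) • n) = R (u + p ^ s • n) * A (u + p ^ s • n) := by
      rw [← h1, ← hjd]
      congr 1
      ext i; simp; ring
    have h5 : A j = R u * A u := by rw [← h1, hjd]
    have hj0 := hA.ne_zero j
    have hu0 := hA.ne_zero u
    have h6 : A (j + p ^ (s + 1) • n) / A j - A (u + p ^ s • n) / A u =
        (R (u + p ^ s • n) - R u) * A (u + p ^ s • n) / A j := by
      have : A (u + p ^ s • n) / A u = R u * A (u + p ^ s • n) / A j := by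
        rw [div_eq_div_iff hu0 hj0, h5]; ring
      rw [this, h4]; ring
    have h7 : padicNorm p (A (u + p ^ s • n)) ≤ padicNorm p (A n) := by
      refine (hA.norm_le_qdiv_pow _ s).trans_eq ?_
      congr 2
      refine qdiv_add_smul (fun i => ?_) n
      rw [pow_succ', ← qdiv_qdiv] at hj
      have := congrFun hj i
      exact (Nat.div_eq_zero_iff.1 this).resolve_left (pow_ne_zero _ hp.out.ne_zero)
    rw [h6, padicNorm.div, padicNorm.mul]
    exact div_le_div_of_nonneg_right (mul_le_mul (h3 s u n) h7 (padicNorm.nonneg _)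
      (by positivity)) (padicNorm.nonneg _)

end Ratio

/-! ### Factorial quotients have Lipschitz ratios -/

section Multinomial

variable {ι : Type*} [Fintype ι]

/-- The quotient of factorials `(P · m)! / ∏ i, (m i)! ^ P i`. -/
def factorialQuot (P m : ι → ℕ) : ℚ := ((P ⬝ᵥ m)! : ℚ) / ∏ i, ((m i)! : ℚ) ^ P i

variable {p : ℕ} [hp : Fact p.Prime]

theorem padicNorm_natCast_eq_one {n : ℕ} (h : p.Coprime n) : padicNorm p (n : ℚ) = 1 :=
  (padicNorm.nat_eq_one_iff _).2 ((Nat.Prime.coprime_iff_not_dvd hp.out).1 h)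

theorem padicNorm_div_sub_div_le {a b c d w q : ℕ} (hb : p.Coprime b) (hd : p.Coprime d)
    (hac : a ≡ w * c [MOD p ^ q]) (hbd : b ≡ w * d [MOD p ^ q]) :
    padicNorm p ((a : ℚ) / b - c / d) ≤ (p : ℚ)⁻¹ ^ q := by
  have hb1 := padicNorm_natCast_eq_one hb
  have hd1 := padicNorm_natCast_eq_one hd
  have hb0 : (b : ℚ) ≠ 0 := fun h => by simp [h] at hb1
  have hd0 : (d : ℚ) ≠ 0 := fun h => by simp [h] at hd1
  have h : a * d ≡ b * c [MOD p ^ q] := by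
    refine (hac.mul_right d).trans ?_
    have := (hbd.mul_right c).symm
    rwa [mul_right_comm] at this
  have hdvd : ((p ^ q : ℕ) : ℤ) ∣ (a * d : ℤ) - b * c := by
    have := (Nat.modEq_iff_dvd.1 h.symm)
    simpa using this
  have hn := padicNorm.dvd_iff_norm_le.1 hdvd
  rw [div_sub_div _ _ hb0 hd0, padicNorm.div, padicNorm.mul, hb1, hd1, mul_one, div_one]
  push_cast at hn
  rw [inv_pow, ← zpow_natCast, ← zpow_neg]
  exact hn

theorem lipschitzRatio_factorialQuot (P : ι → ℕ) : LipschitzRatio p (factorialQuot P) where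
  map_zero := by simp [factorialQuot]
  ne_zero m := div_ne_zero (by positivity) (prod_ne_zero_iff.2 fun i _ => by positivity)
  exists_ratio v hv := by
    have hpq : (p : ℚ) ≠ 0 := by exact_mod_cast hp.out.ne_zero
    have hcop : ∀ m : ι → ℕ, p.Coprime (∏ i, deletedFactorial p (v i) (m i) ^ P i) := fun m =>
      Nat.Coprime.prod_right fun i _ =>
        Nat.Coprime.pow_right _ (coprime_deletedFactorial hp.out (hv i) _)
    -- The factors p^(P·m) and the factorials of the quotient at m split off. Here P·v may be at
    -- least p, so the numerator need not be a unit, but each v_i < p makes the denominator one.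
    refine ⟨fun m => (deletedFactorial p (P ⬝ᵥ v) (P ⬝ᵥ m) : ℚ) /
      ((∏ i, deletedFactorial p (v i) (m i) ^ P i : ℕ) : ℚ), fun m => ?_, fun m => ?_,
      fun s u n => ?_⟩
    · rw [factorialQuot, factorialQuot, dotProduct_add, dotProduct_smul, smul_eq_mul,
        factorial_add_mul_eq hp.out.pos]
      have : ∏ i, (((v + p • m) i)! : ℚ) ^ P i = (p : ℚ) ^ (P ⬝ᵥ m) *
          (∏ i, ((m i)! : ℚ) ^ P i) * ∏ i, (deletedFactorial p (v i) (m i) : ℚ) ^ P i := by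
        rw [dotProduct, ← prod_pow_eq_pow_sum, ← prod_mul_distrib, ← prod_mul_distrib]
        refine prod_congr rfl fun i _ => ?_
        rw [Pi.add_apply, Pi.smul_apply, smul_eq_mul, factorial_add_mul_eq hp.out.pos]
        push_cast
        rw [mul_pow, mul_pow, ← pow_mul, mul_comm (m i)]
      rw [this]
      push_cast
      rw [mul_assoc, mul_assoc, mul_div_mul_left _ _ (pow_ne_zero _ hpq), mul_comm, mul_comm (∏ i, ((m i)! : ℚ) ^ P i), mul_div_mul_comm]
    · rw [padicNorm.div, padicNorm_natCast_eq_one (hcop m), div_one]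
      exact padicNorm.of_nat _
    · refine padicNorm_div_sub_div_le (w := primeToProd p (p ^ s) ^ (P ⬝ᵥ n)) (hcop _) (hcop _)
        ?_ ?_
      · rw [dotProduct_add, dotProduct_smul, smul_eq_mul]
        exact deletedFactorial_add_modEq _ _ _ _ _
      · rw [dotProduct, ← prod_pow_eq_pow_sum, ← prod_mul_distrib]
        refine Nat.ModEq.prod fun i _ => ?_
        rw [mul_comm (P i), pow_mul, ← mul_pow]
        exact (deletedFactorial_add_modEq _ _ _ _ _).pow _

end Multinomial

/-! ### Valuations of the coefficients and harmonic numbers -/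

section Valuation

variable {p : ℕ} [hp : Fact p.Prime]

theorem padicValNat_prod {κ : Type*} {T : Finset κ} {f : κ → ℕ} (hf : ∀ i ∈ T, f i ≠ 0) :
    padicValNat p (∏ i ∈ T, f i) = ∑ i ∈ T, padicValNat p (f i) := by
  simp only [← Nat.factorization_def _ hp.out]
  rw [Nat.factorization_prod hf, Finsupp.finsetSum_apply]

theorem padicNorm_prime_pow (s : ℕ) : padicNorm p ((p : ℚ) ^ s) = (p : ℚ)⁻¹ ^ s := by
  induction s with
  | zero => simp
  | succ s ih => rw [pow_succ, padicNorm.mul, ih, padicNorm.padicNorm_p_of_prime, pow_succ]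

theorem padicNorm_natCast_le {a b : ℕ} (ha : a ≠ 0) (hb : b ≠ 0)
    (h : padicValNat p b ≤ padicValNat p a) : padicNorm p (a : ℚ) ≤ padicNorm p (b : ℚ) := by
  rw [padicNorm.eq_zpow_of_nonzero (by exact_mod_cast ha),
    padicNorm.eq_zpow_of_nonzero (by exact_mod_cast hb), padicValRat.of_nat, padicValRat.of_nat]
  exact zpow_le_zpow_right₀ (by exact_mod_cast hp.out.one_le) (by omega)

variable {ι : Type*} [Fintype ι]

/-- A multiple of q in the interval (q L·⌊m/q⌋, L·m] forces the remainders to satisfy L·(m mod q) ≥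
q, hence P·(m mod q) ≥ q. -/
theorem add_one_le_dotProduct_div {L P m : ι → ℕ} (hLP : L ≤ P) {q x : ℕ} (hq : 0 < q)
    (hqx : q ∣ x) (hx1 : q * (L ⬝ᵥ qdiv m q) < x) (hx2 : x ≤ L ⬝ᵥ m) :
    P ⬝ᵥ qdiv m q + 1 ≤ (P ⬝ᵥ m) / q := by
  obtain ⟨c, rfl⟩ := hqx
  have hc : L ⬝ᵥ qdiv m q + 1 ≤ c := Nat.lt_of_mul_lt_mul_left hx1
  have hm : ∀ Q : ι → ℕ, Q ⬝ᵥ m = Q ⬝ᵥ (fun i => m i % q) + q * (Q ⬝ᵥ qdiv m q) := fun Q => by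
    conv_lhs => rw [← mod_add_smul_qdiv m q, dotProduct_add, dotProduct_smul, smul_eq_mul]
  have hr : L ⬝ᵥ (fun i => m i % q) ≤ P ⬝ᵥ (fun i => m i % q) :=
    sum_le_sum fun i _ => Nat.mul_le_mul_right _ (hLP i)
  rw [Nat.le_div_iff_mul_le hq, hm P]
  have h1 := hm L
  nlinarith

theorem dotProduct_qdiv_le (P m : ι → ℕ) {q : ℕ} (hq : 0 < q) :
    P ⬝ᵥ qdiv m q ≤ (P ⬝ᵥ m) / q := by
  rw [Nat.le_div_iff_mul_le hq, dotProduct, dotProduct, sum_mul]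
  refine sum_le_sum fun i _ => ?_
  rw [mul_assoc]
  exact Nat.mul_le_mul_left _ (Nat.div_mul_le_self _ _)

/-- By Legendre, the valuation of the quotient is Σ_t (⌊P·m/p^t⌋ - P·⌊m/p^t⌋) with nonnegative
terms. Each p^t dividing x = p(L·j) + e, t ≥ 1, makes its term at least 1, because p^t (L·⌊m/p^t⌋) ≤
p(L·j) < x ≤ L·m. -/
theorem padicNorm_factorialQuot_le {L P : ι → ℕ} (hLP : L ≤ P) {a : ι → ℕ} (ha : ∀ i, a i < p)
    (j : ι → ℕ) {e : ℕ} (he0 : 0 < e) (he : e ≤ L ⬝ᵥ a) :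
    padicNorm p (factorialQuot P (a + p • j)) ≤ padicNorm p ((p * (L ⬝ᵥ j) + e : ℕ) : ℚ) := by
  set m := a + p • j with hm
  set x := p * (L ⬝ᵥ j) + e with hx
  set D := ∏ i, (m i)! ^ P i with hD
  have hx0 : x ≠ 0 := by omega
  have hxm : x ≤ L ⬝ᵥ m := by
    rw [hm, dotProduct_add, dotProduct_smul, smul_eq_mul]; omega
  have hD0 : D ≠ 0 := prod_ne_zero_iff.2 fun i _ => pow_ne_zero _ (Nat.factorial_ne_zero _)
  have hval : padicValNat p (x * D) ≤ padicValNat p (P ⬝ᵥ m)! := by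
    -- A common cutoff large enough for all the Legendre sums and for the valuation of x.
    set b := P ⬝ᵥ m + ∑ i, m i + x + 1 with hb
    have hlog : ∀ n, n < b → padicValNat p n ! = ∑ t ∈ Ico 1 b, n / p ^ t := fun n hn =>
      padicValNat_factorial ((Nat.log_le_self _ _).trans_lt hn)
    have hDv : padicValNat p D = ∑ t ∈ Ico 1 b, P ⬝ᵥ qdiv m (p ^ t) := by
      rw [hD, padicValNat_prod fun i _ => pow_ne_zero _ (Nat.factorial_ne_zero _)]
      simp only [dotProduct]
      rw [sum_comm]
      refine sum_congr rfl fun i _ => ?_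
      have : m i ≤ ∑ i, m i := single_le_sum (fun _ _ => Nat.zero_le _) (mem_univ i)
      rw [padicValNat.pow, hlog _ (by omega), mul_sum]
      rfl
    have hxv : padicValNat p x = ∑ t ∈ Ico 1 b, if t ≤ padicValNat p x then 1 else 0 := by
      have hlt : padicValNat p x < b := by
        have := padicValNat_le_nat_log (p := p) x
        have := Nat.log_le_self p x
        omega
      rw [← card_filter]
      have : {t ∈ Ico 1 b | t ≤ padicValNat p x} = Ico 1 (padicValNat p x + 1) := by
        ext t
        simp only [mem_filter, mem_Ico]
        omega
      rw [this, Nat.card_Ico]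
      omega
    rw [padicValNat.mul hx0 hD0, hlog _ (by omega), hDv, hxv, ← sum_add_distrib]
    refine sum_le_sum fun t ht => ?_
    have ht1 := (mem_Ico.1 ht).1
    have hpt : 0 < p ^ t := pow_pos hp.out.pos t
    split_ifs with htx
    · rw [add_comm]
      refine add_one_le_dotProduct_div hLP hpt
        ((pow_dvd_pow p htx).trans pow_padicValNat_dvd) ?_ hxm
      obtain ⟨t, rfl⟩ : ∃ t', t = t' + 1 := ⟨t - 1, by omega⟩
      rw [pow_succ', ← qdiv_qdiv, hm, qdiv_add_smul ha, mul_assoc]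
      have := dotProduct_qdiv_le L j (pow_pos hp.out.pos t)
      have := (Nat.mul_le_mul_left (p ^ t) this).trans (Nat.mul_div_le _ _)
      have := Nat.mul_le_mul_left p this
      omega
    · rw [zero_add]
      exact dotProduct_qdiv_le P m hpt
  have h1 := padicNorm_natCast_le (Nat.factorial_ne_zero _) (mul_ne_zero hx0 hD0) hval
  have hDq : (D : ℚ) = ∏ i, ((m i)! : ℚ) ^ P i := by rw [hD]; push_cast; rfl
  have hpos : 0 < padicNorm p (D : ℚ) :=
    lt_of_le_of_ne (padicNorm.nonneg _) (padicNorm.nonzero (by exact_mod_cast hD0)).symm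
  rw [factorialQuot, ← hDq, padicNorm.div, div_le_iff₀ hpos, ← padicNorm.mul]
  exact_mod_cast h1

end Valuation

/-! ### Harmonic numbers modulo powers of p -/

section Harmonic

variable {p : ℕ} [hp : Fact p.Prime]

/-- In p H_n the terms p/i with p ∣ i add up to H_{⌊n/p⌋}; the others are divisible by p. -/
theorem padicNorm_mul_harmonic_sub_le (n : ℕ) :
    padicNorm p (p * harmonic n - harmonic (n / p)) ≤ (p : ℚ)⁻¹ := by
  have hpq : (p : ℚ) ≠ 0 := by exact_mod_cast hp.out.ne_zero
  induction n with
  | zero => simp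
  | succ n ih =>
    rw [Nat.succ_div, harmonic_succ]
    split_ifs with h
    · obtain ⟨c, hc⟩ := h
      have hnc : n / p + 1 = c := by
        have := Nat.succ_div_of_dvd (a := n) (b := p) ⟨c, hc⟩
        rw [← this, hc, Nat.mul_div_cancel_left _ hp.out.pos]
      have hc0 : (c : ℚ) ≠ 0 := by
        rintro h
        have : c = 0 := by exact_mod_cast h
        simp [this] at hc
      rw [harmonic_succ, hnc, hc]
      push_cast
      have : (p : ℚ) * (harmonic n + (p * c : ℚ)⁻¹) - (harmonic (n / p) + (c : ℚ)⁻¹) =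
          p * harmonic n - harmonic (n / p) := by field_simp; ring
      rwa [this]
    · have : (p : ℚ) * (harmonic n + ((n + 1 : ℕ) : ℚ)⁻¹) - harmonic (n / p + 0) =
          (p * harmonic n - harmonic (n / p)) + p / ((n + 1 : ℕ) : ℚ) := by
        rw [add_zero]; ring
      rw [this]
      refine padicNorm.nonarchimedean.trans (max_le ih ?_)
      rw [padicNorm.div, (padicNorm.nat_eq_one_iff _).2 h, padicNorm.padicNorm_p_of_prime, div_one]

theorem harmonic_add_sub (n c : ℕ) :
    harmonic (n + c) - harmonic n = ∑ i ∈ range c, ((n + (i + 1) : ℕ) : ℚ)⁻¹ := by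
  rw [harmonic, harmonic, sum_range_add, add_sub_cancel_left]
  rfl

theorem padicNorm_mul_harmonic_add_sub_le {x b : ℚ} (hb : 0 ≤ b) {n c : ℕ}
    (h : ∀ e, 0 < e → e ≤ c → padicNorm p x ≤ b * padicNorm p ((n + e : ℕ) : ℚ)) :
    padicNorm p (x * (harmonic (n + c) - harmonic n)) ≤ b := by
  rw [harmonic_add_sub, mul_sum]
  refine padicNorm.sum_le' (fun i hi => ?_) hb
  rw [← div_eq_mul_inv, padicNorm.div]
  have h0 : ((n + (i + 1) : ℕ) : ℚ) ≠ 0 := by positivity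
  rw [div_le_iff₀ (lt_of_le_of_ne (padicNorm.nonneg _) (padicNorm.nonzero h0).symm)]
  exact h _ (by omega) (by have := mem_range.1 hi; omega)

variable {ι : Type*} [Fintype ι] {L : ι → ℕ} {A : (ι → ℕ) → ℚ}

theorem padicNorm_mul_harmonic_div_le
    (hA : ∀ a j : ι → ℕ, (∀ i, a i < p) → ∀ e, 0 < e → e ≤ L ⬝ᵥ a →
      padicNorm p (A (a + p • j)) ≤ padicNorm p ((p * (L ⬝ᵥ j) + e : ℕ) : ℚ))
    {a : ι → ℕ} (ha : ∀ i, a i < p) (j : ι → ℕ) :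
    padicNorm p (A (a + p • j) *
      (harmonic ((L ⬝ᵥ (a + p • j)) / p) - harmonic (L ⬝ᵥ j))) ≤ (p : ℚ)⁻¹ := by
  have : (L ⬝ᵥ (a + p • j)) / p = L ⬝ᵥ j + (L ⬝ᵥ a) / p := by
    rw [dotProduct_add, dotProduct_smul, smul_eq_mul, Nat.add_mul_div_left _ _ hp.out.pos, add_comm]
  rw [this]
  refine padicNorm_mul_harmonic_add_sub_le (by positivity) fun e he0 he => ?_
  refine (hA a j ha (p * e) (Nat.mul_pos hp.out.pos he0) ?_).trans_eq ?_
  · rw [mul_comm]; exact (Nat.le_div_iff_mul_le hp.out.pos).1 he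
  · rw [← mul_add, Nat.cast_mul, padicNorm.mul, padicNorm.padicNorm_p_of_prime]

theorem padicNorm_mul_harmonic_pow_le (hA1 : ∀ m, padicNorm p (A m) ≤ 1)
    (hA : ∀ a j : ι → ℕ, (∀ i, a i < p) → ∀ e, 0 < e → e ≤ L ⬝ᵥ a →
      padicNorm p (A (a + p • j)) ≤ padicNorm p ((p * (L ⬝ᵥ j) + e : ℕ) : ℚ))
    (s : ℕ) (m : ι → ℕ) :
    padicNorm p (A m * (harmonic (L ⬝ᵥ (p ^ s • m)) -
      harmonic (L ⬝ᵥ (p ^ (s + 1) • qdiv m p)))) ≤ (p : ℚ) ^ s := by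
  have hpq : (p : ℚ) ≠ 0 := by exact_mod_cast hp.out.ne_zero
  set j := qdiv m p with hj
  set a : ι → ℕ := fun i => m i % p with ha
  have ham : a + p • j = m := mod_add_smul_qdiv m p
  have hm : L ⬝ᵥ (p ^ s • m) = L ⬝ᵥ (p ^ (s + 1) • j) + p ^ s * (L ⬝ᵥ a) := by
    rw [← ham]
    simp only [dotProduct_add, dotProduct_smul, smul_eq_mul]
    ring
  rw [hm]
  refine padicNorm_mul_harmonic_add_sub_le (by positivity) fun e he0 he => ?_
  rw [dotProduct_smul, smul_eq_mul]
  -- If p^s ∣ e, the factor p^s cancels and the valuation bound on A applies; otherwise the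
  -- denominator has valuation below s, and integrality of A suffices.
  by_cases hdvd : p ^ s ∣ e
  · obtain ⟨f, rfl⟩ := hdvd
    have hf := hA a j (fun i => Nat.mod_lt _ hp.out.pos) f (Nat.pos_of_mul_pos_left he0)
      (Nat.le_of_mul_le_mul_left he (pow_pos hp.out.pos s))
    have h1 : p ^ (s + 1) * (L ⬝ᵥ j) + p ^ s * f = p ^ s * (p * (L ⬝ᵥ j) + f) := by ring
    rw [h1, Nat.cast_mul, padicNorm.mul, Nat.cast_pow, padicNorm_prime_pow, ← mul_assoc, ← mul_pow,
      mul_inv_cancel₀ hpq, one_pow, one_mul, ← ham]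
    exact hf
  · have h1 : ¬ ((p ^ s : ℕ) : ℤ) ∣ ((p ^ (s + 1) * (L ⬝ᵥ j) + e : ℕ) : ℤ) := by
      rw [Int.natCast_dvd_natCast, pow_succ, mul_assoc,
        ← Nat.dvd_add_iff_right (dvd_mul_right _ _)]
      exact hdvd
    rw [padicNorm.dvd_iff_norm_le, not_le, zpow_neg, zpow_natCast, Int.cast_natCast] at h1
    calc _ ≤ (1 : ℚ) := hA1 m
      _ = (p : ℚ) ^ s * ((p : ℚ) ^ s)⁻¹ := (mul_inv_cancel₀ (pow_ne_zero _ hpq)).symm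
      _ ≤ _ := mul_le_mul_of_nonneg_left h1.le (by positivity)

end Harmonic

/-! ### Integrality of the mirror-type maps -/

section MirrorMap

variable {p : ℕ} [hp : Fact p.Prime]

theorem padicNorm_sum_harmonic_le {ι : Type*} [Fintype ι] [DecidableEq ι] {L : ι → ℕ}
    {A : (ι → ℕ) → ℚ} (hD : DworkFamily p A)
    (hA : ∀ a j : ι → ℕ, (∀ i, a i < p) → ∀ e, 0 < e → e ≤ L ⬝ᵥ a →
      padicNorm p (A (a + p • j)) ≤ padicNorm p ((p * (L ⬝ᵥ j) + e : ℕ) : ℚ))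
    {a : ι → ℕ} (ha : ∀ i, a i < p) (K : ι → ℕ) :
    padicNorm p (∑ j ∈ Iic K, A (a + p • j) * A (K - j) *
      (harmonic (L ⬝ᵥ (K - j)) - p * harmonic (L ⬝ᵥ (a + p • j)))) ≤ (p : ℚ)⁻¹ := by
  have hb0 : (0 : ℚ) ≤ (p : ℚ)⁻¹ := by positivity
  have hmain := padicNorm_sum_mul_dworkTerm_le hD ha (h := fun j => harmonic (L ⬝ᵥ j))
    (by simp) (padicNorm_mul_harmonic_pow_le hD.norm_le_one hA) K
  have hrefl : ∑ j ∈ Iic K, A (a + p • j) * A (K - j) * harmonic (L ⬝ᵥ (K - j)) =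
      ∑ j ∈ Iic K, A j * A (a + p • (K - j)) * harmonic (L ⬝ᵥ j) := by
    refine sum_nbij' (fun j => K - j) (fun j => K - j) ?_ ?_ ?_ ?_ ?_
    · intro j _; simp
    · intro j _; simp
    · intro j hj; exact tsub_tsub_cancel_of_le (mem_Iic.1 hj)
    · intro j hj; exact tsub_tsub_cancel_of_le (mem_Iic.1 hj)
    · intro j hj
      rw [tsub_tsub_cancel_of_le (mem_Iic.1 hj), mul_comm (A _) (A (K - j))]
  -- The three pieces are Dwork's sum, the carry error ⌊L·(a+pj)/p⌋ - L·j in the harmonic index, and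
  -- the error in p H_n ≡ H_{⌊n/p⌋}.
  have hsplit : ∑ j ∈ Iic K, A (a + p • j) * A (K - j) *
      (harmonic (L ⬝ᵥ (K - j)) - p * harmonic (L ⬝ᵥ (a + p • j))) =
      -(∑ j ∈ Iic K, harmonic (L ⬝ᵥ j) * dworkTerm A p a K j +
        ∑ j ∈ Iic K, (A (K - j) * (A (a + p • j) *
          (harmonic ((L ⬝ᵥ (a + p • j)) / p) - harmonic (L ⬝ᵥ j))) +
        A (a + p • j) * A (K - j) * (p * harmonic (L ⬝ᵥ (a + p • j)) -
          harmonic ((L ⬝ᵥ (a + p • j)) / p)))) := by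
    simp only [mul_sub (A _ * A _) (harmonic _)]
    rw [sum_sub_distrib, hrefl, ← sum_sub_distrib, ← sum_add_distrib, ← sum_neg_distrib]
    refine sum_congr rfl fun j _ => ?_
    rw [dworkTerm]
    ring
  rw [hsplit, padicNorm.neg]
  refine padicNorm.nonarchimedean.trans (max_le hmain (padicNorm.sum_le' (fun j _ => ?_) hb0))
  refine padicNorm.nonarchimedean.trans (max_le ?_ ?_)
  · rw [padicNorm.mul]
    simpa using mul_le_mul (hD.norm_le_one (K - j)) (padicNorm_mul_harmonic_div_le hA ha j)
      (padicNorm.nonneg _) zero_le_one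
  · rw [padicNorm.mul, padicNorm.mul]
    simpa using mul_le_mul
      (mul_le_one₀ (hD.norm_le_one (a + p • j)) (padicNorm.nonneg _) (hD.norm_le_one (K - j)))
      (padicNorm_mul_harmonic_sub_le (L ⬝ᵥ (a + p • j))) (padicNorm.nonneg _) zero_le_one

/-- Only multiples of p occur as exponents of g(z^p), so the other exponent has the same residues as
m. -/
theorem coeff_mul_expand {d : ℕ} {p : ℕ} (hp : p ≠ 0) (f g : MvPowerSeries (Fin d) ℚ)
    (m : Fin d →₀ ℕ) :
    MvPowerSeries.coeff m (f * MvPowerSeries.expand p hp g) =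
      ∑ j ∈ Iic (qdiv m p),
        MvPowerSeries.coeff (Finsupp.equivFunOnFinite.symm ((fun i => m i % p) + p • j)) f *
        MvPowerSeries.coeff (Finsupp.equivFunOnFinite.symm (qdiv m p - j)) g := by
  rw [MvPowerSeries.coeff_mul]
  symm
  have hp0 : 0 < p := Nat.pos_of_ne_zero hp
  refine sum_of_injOn (fun j => (Finsupp.equivFunOnFinite.symm ((fun i => m i % p) + p • j),
    p • Finsupp.equivFunOnFinite.symm (qdiv m p - j))) ?_ ?_ ?_ ?_
  · intro j _ j' _ h
    have h1 := Finsupp.equivFunOnFinite.symm.injective (congrArg Prod.fst h)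
    ext i
    have := congrFun h1 i
    simpa [hp] using this
  · intro j hj
    rw [mem_coe, HasAntidiagonal.mem_antidiagonal]
    ext i
    have hji := mem_Iic.1 (mem_coe.1 hj) i
    simp only [qdiv_apply] at hji
    simp only [Finsupp.add_apply, Finsupp.equivFunOnFinite_symm_apply_apply, Pi.add_apply,
      Pi.smul_apply, smul_eq_mul, Finsupp.smul_apply, Pi.sub_apply, qdiv_apply]
    rw [add_assoc, ← mul_add, Nat.add_sub_cancel' hji, Nat.mod_add_div]
  · rintro ⟨x, y⟩ hxy hnot
    rw [HasAntidiagonal.mem_antidiagonal] at hxy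
    dsimp only at hxy ⊢
    by_cases hd : ∀ i, p ∣ y i
    · exfalso
      obtain ⟨k, rfl⟩ : ∃ k : Fin d →₀ ℕ, p • k = y :=
        ⟨y.mapRange (fun a => a / p) (by simp), by ext i; simp [Nat.mul_div_cancel' (hd i)]⟩
      refine hnot ⟨qdiv x p, ?_, ?_⟩
      · rw [mem_coe, mem_Iic]
        intro i
        rw [← hxy]
        exact Nat.div_le_div_right (by simp)
      · refine Prod.ext ?_ ?_
        · ext i
          rw [← hxy]
          simp [Nat.mod_add_div]
        · ext i
          rw [← hxy]
          simp [Nat.add_mul_div_left _ _ hp0]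
    · push Not at hd
      obtain ⟨i, hi⟩ := hd
      rw [MvPowerSeries.coeff_expand_of_not_dvd p _ _ hi, mul_zero]
  · intro j _
    rw [MvPowerSeries.coeff_expand_smul]

theorem CoeffLE.expand {d : ℕ} {p q : ℕ} (hq : q ≠ 0) {f : MvPowerSeries (Fin d) ℚ} {c : ℚ}
    (hc : 0 ≤ c) (hf : CoeffLE p f c) : CoeffLE p (MvPowerSeries.expand q hq f) c := fun m => by
  by_cases hd : ∀ i, q ∣ m i
  · obtain ⟨k, rfl⟩ : ∃ k : Fin d →₀ ℕ, q • k = m :=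
      ⟨m.mapRange (fun a => a / q) (by simp), by ext i; simp [Nat.mul_div_cancel' (hd i)]⟩
    rw [MvPowerSeries.coeff_expand_smul]
    exact hf k
  · push Not at hd
    obtain ⟨i, hi⟩ := hd
    rw [MvPowerSeries.coeff_expand_of_not_dvd q _ _ hi, padicNorm.zero]
    exact hc

variable {d k : ℕ}

theorem coeffB_eq_prod (N : Fin k → Fin d → ℕ) (m : Fin d → ℕ) :
    coeffB N (Finsupp.equivFunOnFinite.symm m) = (∏ j, factorialQuot (N j)) m := by
  rw [Finset.prod_apply]
  rfl

theorem dworkFamily_prod_factorialQuot (N : Fin k → Fin d → ℕ) :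
    DworkFamily p (∏ j, factorialQuot (N j)) :=
  (LipschitzRatio.prod _ fun j _ => lipschitzRatio_factorialQuot (N j)).dworkFamily

theorem padicNorm_prod_factorialQuot_le (N : Fin k → Fin d → ℕ) (j₀ : Fin k) (m : Fin d → ℕ) :
    padicNorm p ((∏ j, factorialQuot (N j)) m) ≤ padicNorm p (factorialQuot (N j₀) m) := by
  rw [← mul_prod_erase _ _ (mem_univ j₀), Pi.mul_apply, padicNorm.mul]
  exact mul_le_of_le_one_right (padicNorm.nonneg _)
    ((LipschitzRatio.prod _ fun j _ => lipschitzRatio_factorialQuot (N j)).dworkFamily.norm_le_one _)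

theorem coeffLE_seriesF (N : Fin k → Fin d → ℕ) : CoeffLE p (seriesF N) 1 := fun m => by
  have := (dworkFamily_prod_factorialQuot (p := p) N).norm_le_one m
  rwa [← coeffB_eq_prod, Finsupp.equivFunOnFinite_symm_coe] at this

theorem coeffLE_expand_seriesG_sub (L : Fin d → ℕ) (N : Fin k → Fin d → ℕ) {j₀ : Fin k}
    (hL : L ≤ N j₀) :
    CoeffLE p (seriesF N * MvPowerSeries.expand p hp.out.ne_zero (seriesG L N) -
      p • (seriesG L N * MvPowerSeries.expand p hp.out.ne_zero (seriesF N))) (p : ℚ)⁻¹ := fun m => by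
  have h := padicNorm_sum_harmonic_le (p := p) (L := L) (dworkFamily_prod_factorialQuot N)
    (fun a j ha e he0 he => (padicNorm_prod_factorialQuot_le N j₀ _).trans
      (padicNorm_factorialQuot_le hL ha j he0 he))
    (a := fun i => m i % p) (fun i => Nat.mod_lt _ hp.out.pos) (qdiv m p)
  convert h using 2
  rw [map_sub, map_nsmul, coeff_mul_expand, coeff_mul_expand, nsmul_eq_mul, mul_sum,
    ← sum_sub_distrib]
  refine sum_congr rfl fun j _ => ?_
  have hF : ∀ e : Fin d → ℕ, MvPowerSeries.coeff (Finsupp.equivFunOnFinite.symm e) (seriesF N) =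
      (∏ j, factorialQuot (N j)) e := fun e => coeffB_eq_prod N e
  have hG : ∀ e : Fin d → ℕ, MvPowerSeries.coeff (Finsupp.equivFunOnFinite.symm e) (seriesG L N) =
      harmonic (L ⬝ᵥ e) * (∏ j, factorialQuot (N j)) e := fun e => by
    rw [← coeffB_eq_prod]; rfl
  rw [hF, hF, hG, hG]
  ring

theorem coeffLE_mirrorMap (L : Fin d → ℕ) (N : Fin k → Fin d → ℕ) {j₀ : Fin k} (hL : L ≤ N j₀) :
    CoeffLE p (mirrorMap L N) 1 := by
  have hb0 : (0 : ℚ) ≤ (p : ℚ)⁻¹ := by positivity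
  refine coeffLE_exp_of_expand ?_ ?_
  · rw [map_mul, constantCoeff_seriesG, zero_mul]
  · have hF := seriesF_mul_inv N
    have hinv : CoeffLE p (seriesF N)⁻¹ 1 := (coeffLE_seriesF N).inv (constantCoeff_seriesF N)
    have hE := congrArg (MvPowerSeries.expand p hp.out.ne_zero) hF
    rw [map_mul, map_one] at hE
    have hinv2 := hinv.mul zero_le_one zero_le_one (hinv.expand hp.out.ne_zero zero_le_one)
    rw [mul_one] at hinv2
    have := (coeffLE_expand_seriesG_sub (p := p) L N hL).mul hb0 zero_le_one hinv2
    rw [mul_one] at this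
    convert this using 1
    simp only [nsmul_eq_mul, map_mul]
    -- The two relations cancel F(z) and F(z^p) against their inverses.
    linear_combination
      (-MvPowerSeries.expand p hp.out.ne_zero (seriesG L N) *
        MvPowerSeries.expand p hp.out.ne_zero (seriesF N)⁻¹) * hF +
      (p * seriesG L N * (seriesF N)⁻¹) * hE

end MirrorMap

end MirrorType

theorem theorem2 (d k : ℕ) (hd : 0 < d) (hk : 0 < k) (L : Fin d → ℕ)
    (N : Fin k → Fin d → ℕ) (hL : L ≤ N ⟨0, hk⟩) :
    ∃ Q : MvPowerSeries (Fin d) ℤ,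
      MvPowerSeries.map (Int.castRingHom ℚ) Q = MirrorType.mirrorMap L N := by
  have h : ∀ m, ∃ z : ℤ, (z : ℚ) = MvPowerSeries.coeff m (MirrorType.mirrorMap L N) := fun m =>
    MirrorType.exists_int_of_padicNorm_le_one fun p hp =>
      have := Fact.mk hp
      MirrorType.coeffLE_mirrorMap L N hL m
  choose Q hQ using h
  exact ⟨Q, MvPowerSeries.ext fun m => hQ m⟩
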